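/- For a discrete group $\Gamma$ with identity $e$ and $V\subseteq\Gamma$ put $Z_2(V)=\sup_{g\in\Gamma,\,g\ne e}\#\{(x,y)\in V\times V: x^{-1}y=g\}\in\mathbb N\cup\{\infty\}$. For $A\in M_n(\mathbb C)$ let $\|A\|_{S_1^n}=\mathrm{Tr}\big((A^*A)^{1/2}\big)$ with the unnormalized trace, and for $C_1,\dots,C_d\in M_n(\mathbb C)$ let $$\|(C_k)_{k=1}^d\|_{S_1^n(\ell_2^{rc})}=\inf\Big\{\Big\|\Big(\sum_{k=1}^d X_k^*X_k\Big)^{1/2}\Big\|_{S_1^n}+\Big\|\Big(\sum_{k=1}^d Y_kY_k^*\Big)^{1/2}\Big\|_{S_1^n}: X_k,Y_k\in M_n(\mathbb C),\ C_k=X_k+Y_k\Big\}.$$ Let $G$ be a compact abelian group with normalized Haar measure $\mu$ and (discrete) dual group $\widehat G$, and write $\gamma_x:G\to\mathbb T$ for the character corresponding to $x\in\widehat G$. Say that $W\subseteq\widehat G$ satisfies the matrix-valued lower Khintchine inequality with constant $K$ if, for all $n,d\in\mathbb N$, all $C_1,\dots,C_d\in M_n(\mathbb C)$ and all pairwise distinct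 $x^1,\dots,x^d\in W$, $$K\,\|(C_k)_{k=1}^d\|_{S_1^n(\ell_2^{rc})}\le\int_G\Big\|\sum_{k=1}^d\gamma_{x^k}(g)\,C_k\Big\|_{S_1^n}\,d\mu(g).$$ (1) Let $G=\mathbb Z/k_1\mathbb Z\times\cdots\times\mathbb Z/k_m\mathbb Z\times\prod_{\alpha\in\Lambda}\mathbb T$, where $m\ge 0$, $k_1,\dots,k_m$ are positive integers and $\Lambda$ is an arbitrary index set. If $W\subseteq\widehat G$ satisfies the matrix-valued lower Khintchine inequality with some constant $K>2/\pi$, then $Z_2(W)<\infty$. (2) Let $G=\prod_{\alpha\in\Lambda}\mathbb Z/2\mathbb Z$, where $\Lambda$ is an arbitrary index set. If $W\subseteq\widehat G$ satisfies the matrix-valued lower Khintchine inequality with some constant $K>1/2$, then $Z_2(W)<\infty$. -/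

import Mathlib

noncomputable section

namespace KhintchineZ2

open scoped MatrixOrder

/-- `Z₂(V) = sup_{g ≠ e} #{(x, y) ∈ V × V : x⁻¹ y = g}` for a subset `V` of a discrete group,
as an extended natural number. -/
def Z2 {Γ : Type*} [Group Γ] (V : Set Γ) : ℕ∞ :=
  ⨆ (g : Γ) (_ : g ≠ 1), Set.encard {p : Γ × Γ | p.1 ∈ V ∧ p.2 ∈ V ∧ p.1⁻¹ * p.2 = g}

/-- The trace norm `‖A‖_{S₁ⁿ} = Tr ((A* A)^{1/2})`, with the unnormalized trace. -/
def traceNorm {n : ℕ} (A : Matrix (Fin n) (Fin n) ℂ) : ℝ :=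
  (Matrix.trace (CFC.sqrt (A.conjTranspose * A))).re

/-- The column norm `‖(∑ Xₖ* Xₖ)^{1/2}‖_{S₁ⁿ}`. -/
def columnNorm {n d : ℕ} (X : Fin d → Matrix (Fin n) (Fin n) ℂ) : ℝ :=
  traceNorm (CFC.sqrt (∑ k, (X k).conjTranspose * X k))

/-- The row norm `‖(∑ Yₖ Yₖ*)^{1/2}‖_{S₁ⁿ}`. -/
def rowNorm {n d : ℕ} (Y : Fin d → Matrix (Fin n) (Fin n) ℂ) : ℝ :=
  traceNorm (CFC.sqrt (∑ k, Y k * (Y k).conjTranspose))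

/-- The norm of `S₁ⁿ(ℓ₂^{rc})`: the infimum of `columnNorm X + rowNorm Y` over all decompositions
`C = X + Y`. The set below is nonempty and its elements are nonnegative. -/
def rcNorm {n d : ℕ} (C : Fin d → Matrix (Fin n) (Fin n) ℂ) : ℝ :=
  sInf {r : ℝ | ∃ X Y : Fin d → Matrix (Fin n) (Fin n) ℂ,
    C = X + Y ∧ r = columnNorm X + rowNorm Y}

/-- The Haar measure of a compact group, on the Borel sets, normalized to total mass one. -/
def haarProb (G : Type*) [Group G] [TopologicalSpace G] [IsTopologicalGroup G] [CompactSpace G] :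
    @MeasureTheory.Measure G (borel G) :=
  letI : MeasurableSpace G := borel G
  haveI : BorelSpace G := ⟨rfl⟩
  MeasureTheory.Measure.haarMeasure (⊤ : TopologicalSpace.PositiveCompacts G)

/-- The norm of `∑ₖ Cₖ ⊗ γ_{xₖ}` in the space `L₁` of `S₁ⁿ`-valued functions on the compact
group `G`, where the `xₖ` are characters of `G`. The integrand is a continuous function of `g`. -/
def characterSumNorm {G : Type*} [CommGroup G] [TopologicalSpace G] [IsTopologicalGroup G]
    [CompactSpace G] {n d : ℕ} (C : Fin d → Matrix (Fin n) (Fin n) ℂ)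
    (x : Fin d → PontryaginDual G) : ℝ :=
  letI : MeasurableSpace G := borel G
  ∫ g, traceNorm (∑ k, ((x k g : Circle) : ℂ) • C k) ∂(haarProb G)

/-- The matrix-valued lower Khintchine inequality with constant `K` for a set `W` of characters
of a compact abelian group `G`: it is required for all matrix sizes `n`, all lengths `d`, all
coefficients `C₁, …, C_d ∈ Mₙ(ℂ)` and all pairwise distinct `x¹, …, x^d ∈ W`. -/
def LowerKhintchine {G : Type*} [CommGroup G] [TopologicalSpace G] [IsTopologicalGroup G]
    [CompactSpace G] (W : Set (PontryaginDual G)) (K : ℝ) : Prop :=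
  ∀ (n d : ℕ) (C : Fin d → Matrix (Fin n) (Fin n) ℂ) (x : Fin d → PontryaginDual G),
    Function.Injective x → (∀ k, x k ∈ W) → K * rcNorm C ≤ characterSumNorm C x

end KhintchineZ2

end

/-! ### Trace norms and duality for the row and column norms. -/

namespace KhintchineZ2

open scoped MatrixOrder ComplexOrder
open Matrix

/-! If `Z2 W = ⊤`, then for every d some nontrivial character χ admits d disjoint pairs (xᵢ, xᵢχ) in
W. Put a coefficient aᵢ on xᵢ and -aᵢ on xᵢχ: the sum at g is ∑ xᵢ(g)(1 - χ(g)) aᵢ, whose scalar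
coefficients all have modulus |1 - χ(g)|.

The aᵢ are the fermionic annihilation operators from level n+1 to level n of the antisymmetric Fock
space with d = 2n+1 modes. By the anticommutation relations every combination A = ∑ zᵢaᵢ satisfies
AA*A = ‖z‖²A, so with t = ∑ Tr(aᵢ*aᵢ) the right side of the Khintchine inequality is (mean of |1 -
χ|)·t/√d (`traceNorm_sum_smul`). Row and column square sums of the aᵢ are both at most n+1, so
testing the doubled family against itself gives an rc-norm of at least 2t/√(2n+2)
(`re_sum_trace_le_rcNorm`). If the mean is at most 2c, then K²(2n+1) ≤ c²(2n+2)
(`LowerKhintchine.sq_mul_le`), and n → ∞ forces K ≤ c.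

It remains to bound the mean. The Fourier coefficients of |1 - z| are negative except the zeroth,
4/π, so the mean is at most 4/π and c = 2/π. For a nontrivial character with values ±1 it is exactly
1, and c = 1/2. -/

lemma traceNorm_of_sq_eq {n : ℕ} (A B : Matrix (Fin n) (Fin n) ℂ) (hB : B.PosSemidef)
    (h : B * B = Aᴴ * A) : traceNorm A = B.trace.re := by
  unfold traceNorm
  rw [CFC.sqrt_unique h (Matrix.nonneg_iff_posSemidef.2 hB)]

lemma traceNorm_eq_of_posSemidef {n : ℕ} {B : Matrix (Fin n) (Fin n) ℂ} (hB : B.PosSemidef) :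
    traceNorm B = B.trace.re :=
  traceNorm_of_sq_eq B B hB (by rw [hB.isHermitian.eq])

lemma sqrt_eq_conj_diagonal {n : ℕ} {M : Matrix (Fin n) (Fin n) ℂ} (hM : M.PosSemidef) :
    CFC.sqrt M = (hM.isHermitian.eigenvectorUnitary : Matrix (Fin n) (Fin n) ℂ) *
      diagonal (fun l => ((√(hM.isHermitian.eigenvalues l) : ℝ) : ℂ)) *
      (hM.isHermitian.eigenvectorUnitary : Matrix (Fin n) (Fin n) ℂ)ᴴ := by
  set U := (hM.isHermitian.eigenvectorUnitary : Matrix (Fin n) (Fin n) ℂ) with hU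
  have hUU : Uᴴ * U = 1 := Unitary.coe_star_mul_self hM.isHermitian.eigenvectorUnitary
  have hspec : M = U * diagonal (fun l => ((hM.isHermitian.eigenvalues l : ℝ) : ℂ)) * Uᴴ :=
    hM.isHermitian.spectral_theorem
  refine CFC.sqrt_unique ?_ (Matrix.nonneg_iff_posSemidef.2 ?_)
  · calc _ = U * diagonal (fun l => ((√(hM.isHermitian.eigenvalues l) : ℝ) : ℂ)) * (Uᴴ * U) *
        diagonal (fun l => ((√(hM.isHermitian.eigenvalues l) : ℝ) : ℂ)) * Uᴴ := by
          simp only [Matrix.mul_assoc]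
      _ = _ := by
        rw [hUU, Matrix.mul_one, Matrix.mul_assoc U, diagonal_mul_diagonal]
        conv_rhs => rw [hspec]
        congr 3
        ext l
        rw [← Complex.ofReal_mul, Real.mul_self_sqrt (hM.eigenvalues_nonneg l)]
  · refine (Matrix.PosSemidef.diagonal fun l => ?_).mul_mul_conjTranspose_same U
    exact Complex.zero_le_real.2 (Real.sqrt_nonneg _)

lemma traceNorm_sqrt {n : ℕ} {M : Matrix (Fin n) (Fin n) ℂ} (hM : M.PosSemidef) :
    traceNorm (CFC.sqrt M) = ∑ l, √(hM.isHermitian.eigenvalues l) := by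
  rw [traceNorm_eq_of_posSemidef (Matrix.nonneg_iff_posSemidef.1 (CFC.sqrt_nonneg M)),
    sqrt_eq_conj_diagonal hM, Matrix.trace_mul_cycle]
  have : (hM.isHermitian.eigenvectorUnitary : Matrix (Fin n) (Fin n) ℂ)ᴴ *
      (hM.isHermitian.eigenvectorUnitary : Matrix (Fin n) (Fin n) ℂ) = 1 :=
    Unitary.coe_star_mul_self hM.isHermitian.eigenvectorUnitary
  rw [this, Matrix.one_mul, Matrix.trace_diagonal, Complex.re_sum]
  simp

lemma sum_conjTranspose_mul_diag_re {n d : ℕ} (X : Fin d → Matrix (Fin n) (Fin n) ℂ) (l : Fin n) :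
    ((∑ k, (X k)ᴴ * X k) l l).re = ∑ p : Fin d × Fin n, ‖X p.1 p.2 l‖ ^ 2 := by
  rw [Matrix.sum_apply, Complex.re_sum, Fintype.sum_prod_type]
  refine Finset.sum_congr rfl fun k _ => ?_
  rw [Matrix.mul_apply, Complex.re_sum]
  refine Finset.sum_congr rfl fun j _ => ?_
  rw [Matrix.conjTranspose_apply, ← Complex.normSq_eq_norm_sq, Complex.star_def,
    ← Complex.normSq_eq_conj_mul_self, Complex.ofReal_re]

lemma posSemidef_sum_conjTranspose_mul {n d : ℕ} (X : Fin d → Matrix (Fin n) (Fin n) ℂ) :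
    (∑ k, (X k)ᴴ * X k).PosSemidef :=
  Matrix.posSemidef_sum _ fun k _ => Matrix.posSemidef_conjTranspose_mul_self (X k)

/-- Duality between the column trace norm and the column operator norm. -/
lemma re_sum_trace_le_columnNorm {n d : ℕ} (X B : Fin d → Matrix (Fin n) (Fin n) ℂ) {β : ℝ}
    (hβ : 0 ≤ β)
    (hB : (((β ^ 2 : ℝ) : ℂ) • (1 : Matrix (Fin n) (Fin n) ℂ) - ∑ k, (B k)ᴴ * B k).PosSemidef) :
    (∑ k, ((B k)ᴴ * X k).trace).re ≤ β * columnNorm X := by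
  have hM := posSemidef_sum_conjTranspose_mul X
  rw [columnNorm, traceNorm_sqrt hM]
  set lam := hM.isHermitian.eigenvalues
  set U := (hM.isHermitian.eigenvectorUnitary : Matrix (Fin n) (Fin n) ℂ) with hU
  have hUU : Uᴴ * U = 1 := Unitary.coe_star_mul_self hM.isHermitian.eigenvectorUnitary
  have hUU' : U * Uᴴ = 1 := Unitary.coe_mul_star_self hM.isHermitian.eigenvectorUnitary
  have hspec : (∑ k, (X k)ᴴ * X k) = U * diagonal (fun l => ((lam l : ℝ) : ℂ)) * Uᴴ :=
    hM.isHermitian.spectral_theorem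
  have hconj : ∀ Z : Fin d → Matrix (Fin n) (Fin n) ℂ,
      ∑ k, (Z k * U)ᴴ * (Z k * U) = Uᴴ * (∑ k, (Z k)ᴴ * Z k) * U := fun Z => by
    rw [Finset.mul_sum, Finset.sum_mul]
    simp only [Matrix.conjTranspose_mul, Matrix.mul_assoc]
  -- In the eigenbasis of ∑ Xₖ*Xₖ, stack the l-th columns of all XₖU into one vector: its squared
  -- length is the l-th eigenvalue. Cauchy–Schwarz is then applied for each l.
  have hX : ∀ l, ∑ p : Fin d × Fin n, ‖(X p.1 * U) p.2 l‖ ^ 2 = lam l := fun l => by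
    rw [← sum_conjTranspose_mul_diag_re (fun k => X k * U), hconj, hspec]
    have : Uᴴ * (U * diagonal (fun l => ((lam l : ℝ) : ℂ)) * Uᴴ) * U =
        (Uᴴ * U) * diagonal (fun l => ((lam l : ℝ) : ℂ)) * (Uᴴ * U) := by
      simp only [Matrix.mul_assoc]
    rw [this, hUU]
    simp
  have hB' : ∀ l, ∑ p : Fin d × Fin n, ‖(B p.1 * U) p.2 l‖ ^ 2 ≤ β ^ 2 := fun l => by
    rw [← sum_conjTranspose_mul_diag_re (fun k => B k * U), hconj]
    have h := (hB.conjTranspose_mul_mul_same U).diag_nonneg (i := l)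
    rw [Matrix.mul_sub, Matrix.sub_mul, Matrix.mul_smul, Matrix.mul_one, Matrix.smul_mul, hUU] at h
    have h2 := (Complex.le_def.1 h).1
    simp only [Matrix.sub_apply, Matrix.smul_apply, Matrix.one_apply_eq, Complex.sub_re,
      smul_eq_mul, mul_one, Complex.ofReal_re, Complex.zero_re] at h2
    linarith
  have htr : ∀ k, ((B k)ᴴ * X k).trace = ((B k * U)ᴴ * (X k * U)).trace := fun k => by
    rw [Matrix.conjTranspose_mul, Matrix.mul_assoc, Matrix.trace_mul_comm Uᴴ, ← Matrix.mul_assoc,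
      Matrix.mul_assoc, hUU', Matrix.mul_one]
  calc (∑ k, ((B k)ᴴ * X k).trace).re
      = ∑ l, ∑ p : Fin d × Fin n, (star ((B p.1 * U) p.2 l) * (X p.1 * U) p.2 l).re := by
        rw [Finset.sum_congr rfl fun k _ => htr k]
        simp only [Matrix.trace, Matrix.diag_apply, Matrix.mul_apply (M := (_)ᴴ),
          Matrix.conjTranspose_apply, Complex.re_sum, Fintype.sum_prod_type]
        rw [Finset.sum_comm]
    _ ≤ ∑ l, ∑ p : Fin d × Fin n, ‖(B p.1 * U) p.2 l‖ * ‖(X p.1 * U) p.2 l‖ := by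
        refine Finset.sum_le_sum fun l _ => Finset.sum_le_sum fun p _ => ?_
        refine (Complex.re_le_norm _).trans ?_
        rw [norm_mul, norm_star]
    _ ≤ ∑ l, β * √(lam l) := by
        refine Finset.sum_le_sum fun l _ => ?_
        refine (Real.sum_mul_le_sqrt_mul_sqrt _ _ _).trans ?_
        rw [hX]
        gcongr
        exact (Real.sqrt_le_left hβ).2 (hB' l)
    _ = _ := by rw [Finset.mul_sum]

lemma rowNorm_eq_columnNorm {n d : ℕ} (Y : Fin d → Matrix (Fin n) (Fin n) ℂ) :
    rowNorm Y = columnNorm fun k => (Y k)ᴴ := by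
  simp [rowNorm, columnNorm]

lemma re_sum_trace_le_rowNorm {n d : ℕ} (Y B : Fin d → Matrix (Fin n) (Fin n) ℂ) {β : ℝ}
    (hβ : 0 ≤ β)
    (hB : (((β ^ 2 : ℝ) : ℂ) • (1 : Matrix (Fin n) (Fin n) ℂ) - ∑ k, B k * (B k)ᴴ).PosSemidef) :
    (∑ k, ((B k)ᴴ * Y k).trace).re ≤ β * rowNorm Y := by
  rw [rowNorm_eq_columnNorm]
  have h := re_sum_trace_le_columnNorm (fun k => (Y k)ᴴ) (fun k => (B k)ᴴ) hβ (by simpa using hB)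
  refine le_trans (le_of_eq ?_) h
  rw [Complex.re_sum, Complex.re_sum]
  refine Finset.sum_congr rfl fun k _ => ?_
  rw [Matrix.conjTranspose_conjTranspose, Matrix.trace_mul_comm (B k),
    ← Complex.conj_re, ← Complex.star_def, ← Matrix.trace_conjTranspose, Matrix.conjTranspose_mul,
    Matrix.conjTranspose_conjTranspose]

/-- A lower bound of the norm of `S₁ⁿ(ℓ₂^{rc})` by testing a family against itself. -/
lemma re_sum_trace_le_rcNorm {n d : ℕ} (C : Fin d → Matrix (Fin n) (Fin n) ℂ) {β : ℝ}
    (hβ : 0 ≤ β)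
    (hcol : (((β ^ 2 : ℝ) : ℂ) • (1 : Matrix (Fin n) (Fin n) ℂ) - ∑ k, (C k)ᴴ * C k).PosSemidef)
    (hrow : (((β ^ 2 : ℝ) : ℂ) • (1 : Matrix (Fin n) (Fin n) ℂ) - ∑ k, C k * (C k)ᴴ).PosSemidef) :
    (∑ k, ((C k)ᴴ * C k).trace).re ≤ β * rcNorm C := by
  rcases hβ.eq_or_lt with rfl | hpos
  · have h := re_sum_trace_le_columnNorm C C le_rfl hcol
    simpa using h
  rw [mul_comm, ← div_le_iff₀ hpos]
  refine le_csInf ⟨_, C, 0, by simp, rfl⟩ ?_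
  rintro r ⟨X, Y, hC, rfl⟩
  rw [div_le_iff₀ hpos, mul_comm, mul_add]
  refine le_trans (le_of_eq ?_) (add_le_add (re_sum_trace_le_columnNorm X C hβ hcol)
    (re_sum_trace_le_rowNorm Y C hβ hrow))
  rw [← Complex.add_re, ← Finset.sum_add_distrib]
  congr 1
  refine Finset.sum_congr rfl fun k _ => ?_
  rw [← Matrix.trace_add, ← Matrix.mul_add]
  congr 2
  rw [hC]; rfl

end KhintchineZ2

/-! ### Canonical anticommutation relations. -/

namespace KhintchineZ2

open Matrix

/-- The sign `(-1)^{#{j ∈ S : j < i}}`. -/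
def fermionSign {d : ℕ} (i : Fin d) (S : Finset (Fin d)) : ℂ :=
  (-1) ^ (S.filter (· < i)).card

/-- The annihilation operators of the antisymmetric Fock space, in the basis indexed by
subsets. -/
def annihilation {d : ℕ} (i : Fin d) : Matrix (Finset (Fin d)) (Finset (Fin d)) ℂ :=
  Matrix.of fun S T => if i ∉ S ∧ T = insert i S then fermionSign i S else 0

lemma fermionSign_mul_self {d : ℕ} (i : Fin d) (S : Finset (Fin d)) :
    fermionSign i S * fermionSign i S = 1 := by
  rw [fermionSign, ← pow_add, ← two_mul, pow_mul]; simp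

lemma star_fermionSign {d : ℕ} (i : Fin d) (S : Finset (Fin d)) :
    star (fermionSign i S) = fermionSign i S := by
  simp [fermionSign]

lemma fermionSign_insert_of_le {d : ℕ} {i j : Fin d} (h : i ≤ j) (S : Finset (Fin d)) :
    fermionSign i (insert j S) = fermionSign i S := by
  rw [fermionSign, Finset.filter_insert, if_neg (not_lt.2 h), fermionSign]

lemma fermionSign_insert_of_lt {d : ℕ} {i j : Fin d} (h : j < i) {S : Finset (Fin d)}
    (hj : j ∉ S) : fermionSign i (insert j S) = -fermionSign i S := by
  rw [fermionSign, Finset.filter_insert, if_pos h, Finset.card_insert_of_notMem (by simp [hj]),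
    fermionSign, pow_succ]
  ring

/-- Of the two insertions, only that of the smaller index changes the sign of the other; this is the
source of all anticommutation. -/
lemma fermionSign_swap {d : ℕ} {i j : Fin d} (h : i ≠ j) {S : Finset (Fin d)} (hi : i ∉ S)
    (hj : j ∉ S) :
    fermionSign i S * fermionSign j (insert i S) =
      -(fermionSign j S * fermionSign i (insert j S)) := by
  rcases lt_or_gt_of_ne h with h | h
  · rw [fermionSign_insert_of_lt h hi, fermionSign_insert_of_le h.le]; ring
  · rw [fermionSign_insert_of_lt h hj, fermionSign_insert_of_le h.le]; ring

lemma annihilation_mul_apply {d : ℕ} (i : Fin d)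
    (M : Matrix (Finset (Fin d)) (Finset (Fin d)) ℂ) (S T : Finset (Fin d)) :
    (annihilation i * M) S T = if i ∈ S then 0 else fermionSign i S * M (insert i S) T := by
  rw [Matrix.mul_apply]
  by_cases hi : i ∈ S
  · simp [annihilation, hi]
  · simp [annihilation, hi, ite_mul]

lemma creation_apply {d : ℕ} (i : Fin d) (S T : Finset (Fin d)) :
    (annihilation i)ᴴ S T = if i ∉ T ∧ S = insert i T then fermionSign i T else 0 := by
  rw [Matrix.conjTranspose_apply, annihilation, Matrix.of_apply]
  split_ifs
  · exact star_fermionSign i T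
  · simp

lemma creation_mul_apply {d : ℕ} (i : Fin d)
    (M : Matrix (Finset (Fin d)) (Finset (Fin d)) ℂ) (S T : Finset (Fin d)) :
    ((annihilation i)ᴴ * M) S T =
      if i ∈ S then fermionSign i (S.erase i) * M (S.erase i) T else 0 := by
  rw [Matrix.mul_apply]
  simp only [creation_apply]
  by_cases hi : i ∈ S
  · rw [Finset.sum_eq_single (S.erase i)]
    · simp [hi]
    · rintro R - hR
      rw [if_neg, zero_mul]
      rintro ⟨h1, rfl⟩
      exact hR (Finset.erase_insert h1).symm
    · simp
  · rw [if_neg hi]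
    refine Finset.sum_eq_zero fun R _ => ?_
    rw [if_neg, zero_mul]
    rintro ⟨h1, rfl⟩
    exact hi (Finset.mem_insert_self _ _)

lemma annihilation_anticomm {d : ℕ} (i j : Fin d) :
    annihilation i * annihilation j + annihilation j * annihilation i = 0 := by
  ext S T
  rw [Matrix.add_apply, annihilation_mul_apply, annihilation_mul_apply]
  rcases eq_or_ne i j with rfl | hij
  · by_cases hi : i ∈ S <;> simp [annihilation, hi]
  · by_cases hi : i ∈ S
    · simp [annihilation, hi]
    · by_cases hj : j ∈ S
      · simp [annihilation, hj]
      · simp only [hi, hj, annihilation, Matrix.of_apply, Finset.mem_insert, hij, hij.symm,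
          if_false, or_self, not_false_eq_true, true_and, Matrix.zero_apply, mul_ite, mul_zero,
          Finset.insert_comm j i S]
        split_ifs
        · rw [fermionSign_swap hij hi hj]; ring
        · simp

lemma annihilation_creation {d : ℕ} (i j : Fin d) :
    annihilation i * (annihilation j)ᴴ + (annihilation j)ᴴ * annihilation i =
      if i = j then 1 else 0 := by
  ext S T
  rw [Matrix.add_apply, annihilation_mul_apply, creation_mul_apply, creation_apply]
  rcases eq_or_ne i j with rfl | hij
  · by_cases hi : i ∈ S
    · simp only [hi, annihilation, Matrix.of_apply, if_true, Finset.notMem_erase,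
        not_false_eq_true, true_and, Finset.insert_erase hi, zero_add, Matrix.one_apply, mul_ite,
        mul_zero, fermionSign_mul_self]
      by_cases h : S = T
      · simp [h]
      · simp [h, Ne.symm h]
    · simp only [hi, if_false, if_true, add_zero, Matrix.one_apply]
      by_cases h : S = T
      · subst h
        simp [hi, fermionSign_mul_self]
      · rw [if_neg h, if_neg, mul_zero]
        rintro ⟨h1, h2⟩
        exact h (by rw [← Finset.erase_insert hi, h2, Finset.erase_insert h1])
  · simp only [hij, if_false, Matrix.zero_apply, annihilation, Matrix.of_apply]
    by_cases hi : i ∈ S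
    · simp [hi, hij]
    by_cases hj : j ∈ S
    · obtain ⟨R, hR, rfl⟩ : ∃ R, j ∉ R ∧ S = insert j R :=
        ⟨S.erase j, Finset.notMem_erase _ _, (Finset.insert_erase hj).symm⟩
      have hiR : i ∉ R := fun h => hi (Finset.mem_insert_of_mem h)
      rw [if_neg hi, if_pos hj, Finset.erase_insert hR]
      by_cases h : T = insert i R
      · subst h
        have h1 : insert i (insert j R) = insert j (insert i R) := Finset.insert_comm _ _ _
        have h2 : j ∉ insert i R := by simp [hR, hij.symm]
        rw [if_pos ⟨h2, h1⟩, if_pos ⟨hiR, rfl⟩]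
        have h3 := fermionSign_swap hij hiR hR
        -- The swap identity multiplied by two signs, whose squares are then replaced by 1.
        linear_combination fermionSign i (insert j R) * fermionSign i R * h3
          - fermionSign i (insert j R) * fermionSign j (insert i R) * fermionSign_mul_self i R
          - fermionSign i R * fermionSign j R * fermionSign_mul_self i (insert j R)
      · rw [if_neg, if_neg]
        · simp
        · exact fun h' => h h'.2
        · rintro ⟨h1, h2⟩
          refine h ?_
          have h3 : j ∉ insert i R := by simp [hR, hij.symm]
          rw [← Finset.erase_insert h1, ← h2, Finset.insert_comm, Finset.erase_insert h3]
    · have : ¬ (j ∉ T ∧ insert i S = insert j T) := by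
        rintro ⟨-, h⟩
        have : j ∈ insert i S := h ▸ Finset.mem_insert_self _ _
        simp [hij.symm, hj] at this
      simp [hi, hj, this]

end KhintchineZ2

/-! ### The partial isometry family on one level of the Fock space. -/

namespace KhintchineZ2

open scoped MatrixOrder ComplexOrder
open Matrix

/-- The projection onto the span of the subsets of cardinality `k`. -/
def levelProj (d k : ℕ) : Matrix (Finset (Fin d)) (Finset (Fin d)) ℂ :=
  diagonal fun S => if S.card = k then 1 else 0

lemma levelProj_mul_self (d k : ℕ) : levelProj d k * levelProj d k = levelProj d k := by
  rw [levelProj, diagonal_mul_diagonal]; simp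

lemma conjTranspose_levelProj (d k : ℕ) : (levelProj d k)ᴴ = levelProj d k := by
  rw [levelProj, diagonal_conjTranspose]
  congr 1; ext S; simp [apply_ite]

/-- Annihilation lowers the cardinality by one, so restricting the source level is the same as
restricting the target level. -/
lemma annihilation_mul_levelProj {d : ℕ} (i : Fin d) (k : ℕ) :
    annihilation i * levelProj d (k + 1) = levelProj d k * annihilation i := by
  ext S T
  rw [levelProj, levelProj, mul_diagonal, diagonal_mul, annihilation, Matrix.of_apply]
  by_cases h : i ∉ S ∧ T = insert i S
  · obtain ⟨h1, rfl⟩ := h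
    simp [h1, Finset.card_insert_of_notMem]
  · simp [h]

lemma creation_mul_annihilation {d : ℕ} (i : Fin d) :
    (annihilation i)ᴴ * annihilation i = diagonal fun S => if i ∈ S then 1 else 0 := by
  ext S T
  rw [creation_mul_apply, annihilation, Matrix.of_apply, diagonal_apply]
  by_cases hi : i ∈ S
  · by_cases h : S = T
    · simp [← h, hi, fermionSign_mul_self]
    · simp [h, hi, Ne.symm h]
  · simp [hi]

lemma annihilation_mul_creation {d : ℕ} (i : Fin d) :
    annihilation i * (annihilation i)ᴴ = diagonal fun S => if i ∈ S then 0 else 1 := by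
  have h := annihilation_creation i i
  rw [creation_mul_annihilation, if_pos rfl] at h
  rw [eq_sub_of_add_eq h, ← diagonal_one, diagonal_sub]
  congr 1; ext S; split_ifs <;> simp

lemma sum_creation_mul_annihilation (d : ℕ) :
    ∑ i : Fin d, (annihilation i)ᴴ * annihilation i = diagonal fun S => (S.card : ℂ) := by
  simp only [creation_mul_annihilation]
  ext S T
  rw [Matrix.sum_apply]
  by_cases h : S = T <;> simp [h]

lemma sum_annihilation_mul_creation (d : ℕ) :
    ∑ i : Fin d, annihilation i * (annihilation i)ᴴ = diagonal fun S => (d : ℂ) - S.card := by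
  simp only [annihilation_mul_creation]
  ext S T
  rw [Matrix.sum_apply]
  by_cases h : S = T
  · simp only [diagonal_apply, h, if_true]
    have : ∀ i : Fin d, (if i ∈ T then (0 : ℂ) else 1) = 1 - if i ∈ T then 1 else 0 := fun i => by
      split_ifs <;> simp
    simp [this]
  · simp [h]

lemma trace_creation_mul_annihilation_mul_levelProj {d : ℕ} {i j : Fin d} (hij : i ≠ j) (k : ℕ) :
    ((annihilation i)ᴴ * annihilation j * levelProj d k).trace = 0 := by
  refine Finset.sum_eq_zero fun S _ => ?_
  rw [diag_apply, levelProj, mul_diagonal, creation_mul_apply, annihilation, Matrix.of_apply]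
  split_ifs with h1 h2 h3 <;> simp only [mul_zero, mul_one]
  exfalso
  have : j ∈ S := by rw [h2.2]; exact Finset.mem_insert_self _ _
  exact h2.1 (Finset.mem_erase.2 ⟨hij.symm, this⟩)

lemma sum_smul_annihilation_mul_self {d : ℕ} (z : Fin d → ℂ) :
    (∑ i, z i • annihilation i) * (∑ i, z i • annihilation i) = 0 := by
  have h : ∀ A : Matrix (Finset (Fin d)) (Finset (Fin d)) ℂ, A + A = 0 → A = 0 := fun A hA => by
    rw [← two_smul ℂ] at hA
    simpa using hA
  apply h
  rw [Finset.sum_mul_sum]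
  conv_lhs =>
    rhs
    rw [Finset.sum_comm]
  rw [← Finset.sum_add_distrib]
  refine Finset.sum_eq_zero fun i _ => ?_
  rw [← Finset.sum_add_distrib]
  refine Finset.sum_eq_zero fun j _ => ?_
  rw [smul_mul_smul_comm, smul_mul_smul_comm, mul_comm (z j), ← smul_add, annihilation_anticomm,
    smul_zero]

lemma sum_smul_annihilation_anticomm {d : ℕ} (z : Fin d → ℂ) :
    (∑ i, z i • annihilation i) * (∑ i, z i • annihilation i)ᴴ +
      (∑ i, z i • annihilation i)ᴴ * (∑ i, z i • annihilation i) =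
      ((∑ i, ‖z i‖ ^ 2 : ℝ) : ℂ) • 1 := by
  rw [conjTranspose_sum, Finset.sum_mul_sum, Finset.sum_mul_sum]
  conv_lhs =>
    rhs
    rw [Finset.sum_comm]
  rw [← Finset.sum_add_distrib, Complex.ofReal_sum, Finset.sum_smul]
  refine Finset.sum_congr rfl fun i _ => ?_
  rw [← Finset.sum_add_distrib, Finset.sum_eq_single i]
  · rw [conjTranspose_smul, smul_mul_smul_comm, smul_mul_smul_comm, mul_comm (star (z i)),
      ← smul_add, annihilation_creation, if_pos rfl, Complex.star_def, Complex.mul_conj,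
      Complex.normSq_eq_norm_sq]
  · intro j _ hj
    rw [conjTranspose_smul, smul_mul_smul_comm, smul_mul_smul_comm, mul_comm (star (z j)),
      ← smul_add, annihilation_creation, if_neg hj.symm, smul_zero]
  · simp

/-- With s = ∑ ‖zᵢ‖², AA* = s - A*A and A² = 0 give AA*A = sA, so A is a multiple of a partial
isometry. -/
lemma mul_conjTranspose_mul_sum_smul_annihilation {d : ℕ} (z : Fin d → ℂ) :
    (∑ i, z i • annihilation i) * (∑ i, z i • annihilation i)ᴴ * (∑ i, z i • annihilation i) =
      ((∑ i, ‖z i‖ ^ 2 : ℝ) : ℂ) • ∑ i, z i • annihilation i := by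
  rw [eq_sub_of_add_eq (sum_smul_annihilation_anticomm z), Matrix.sub_mul, Matrix.mul_assoc,
    sum_smul_annihilation_mul_self, Matrix.mul_zero, sub_zero, Matrix.smul_mul, Matrix.one_mul]

/-- The annihilation operators restricted to one level of the antisymmetric Fock space of a space
of odd dimension: they span a space of multiples of partial isometries, and their row and column
square functions are small. -/
theorem exists_partial_isometry_family (n : ℕ) :
    ∃ (N : ℕ) (a : Fin (2 * n + 1) → Matrix (Fin N) (Fin N) ℂ) (t : ℝ), 0 < t ∧
      (∀ z : Fin (2 * n + 1) → ℂ, (∑ i, z i • a i) * (∑ i, z i • a i)ᴴ * (∑ i, z i • a i) =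
        ((∑ i, ‖z i‖ ^ 2 : ℝ) : ℂ) • ∑ i, z i • a i) ∧
      (((n + 1 : ℝ) : ℂ) • (1 : Matrix (Fin N) (Fin N) ℂ) - ∑ i, (a i)ᴴ * a i).PosSemidef ∧
      (((n + 1 : ℝ) : ℂ) • (1 : Matrix (Fin N) (Fin N) ℂ) - ∑ i, a i * (a i)ᴴ).PosSemidef ∧
      (∀ i j, i ≠ j → ((a i)ᴴ * a j).trace = 0) ∧ ∑ i, ((a i)ᴴ * a i).trace = (t : ℂ) := by
  set d := 2 * n + 1 with hd
  let e := Fintype.equivFin (Finset (Fin d))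
  let φ := Matrix.reindexAlgEquiv ℂ ℂ e
  have hφs : ∀ M, φ Mᴴ = (φ M)ᴴ := fun M => (Matrix.conjTranspose_reindex e e M).symm
  have hφt : ∀ M, (φ M).trace = M.trace := fun M => by
    simp only [φ, Matrix.trace, Matrix.diag_apply, Matrix.coe_reindexAlgEquiv,
      Matrix.reindex_apply, Matrix.submatrix_apply]
    exact Equiv.sum_comp e.symm fun i => M i i
  have hφp : ∀ M : Matrix (Finset (Fin d)) (Finset (Fin d)) ℂ, M.PosSemidef → (φ M).PosSemidef :=
    fun M hM => hM.submatrix e.symm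
  let b : Fin d → Matrix (Finset (Fin d)) (Finset (Fin d)) ℂ :=
    fun i => annihilation i * levelProj d (n + 1)
  have hb : ∀ i, b i = levelProj d n * annihilation i := fun i => annihilation_mul_levelProj i n
  have hbb : ∀ i j, (b i)ᴴ * b j = (annihilation i)ᴴ * annihilation j * levelProj d (n + 1) := by
    intro i j
    rw [hb i, hb j, Matrix.conjTranspose_mul, conjTranspose_levelProj]
    calc _ = (annihilation i)ᴴ * (levelProj d n * levelProj d n * annihilation j) := by
          simp only [Matrix.mul_assoc]
      _ = _ := by rw [levelProj_mul_self, ← annihilation_mul_levelProj, Matrix.mul_assoc]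
  have hcol : ∑ i, (b i)ᴴ * b i = diagonal fun S => if S.card = n + 1 then (n + 1 : ℂ) else 0 := by
    simp only [hbb]
    rw [← Finset.sum_mul, sum_creation_mul_annihilation, levelProj, diagonal_mul_diagonal]
    congr 1; ext S
    split_ifs with h <;> simp [h]
  have hrow : ∑ i, b i * (b i)ᴴ = diagonal fun S => if S.card = n then (n + 1 : ℂ) else 0 := by
    have : ∀ i, b i * (b i)ᴴ = levelProj d n * (annihilation i * (annihilation i)ᴴ) := by
      intro i
      rw [hb i, Matrix.conjTranspose_mul, conjTranspose_levelProj, annihilation_mul_creation,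
        Matrix.mul_assoc, ← Matrix.mul_assoc (annihilation i), annihilation_mul_creation, levelProj,
        diagonal_mul_diagonal, diagonal_mul_diagonal, diagonal_mul_diagonal]
      congr 1; ext S
      split_ifs <;> simp
    simp only [this]
    rw [← Finset.mul_sum, sum_annihilation_mul_creation, levelProj, diagonal_mul_diagonal]
    congr 1; ext S
    split_ifs with h
    -- On level n the value is d - n = n+1, equal to the column value on level n+1; this balance is
    -- why d is odd.
    · rw [h, hd]; push_cast; ring
    · simp
  have hpos : ∀ k : ℕ, ((((n + 1 : ℝ) : ℂ) • (1 : Matrix (Finset (Fin d)) (Finset (Fin d)) ℂ)) -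
      diagonal fun S : Finset (Fin d) => if S.card = k then (n + 1 : ℂ) else 0).PosSemidef := by
    intro k
    rw [smul_one_eq_diagonal, diagonal_sub]
    refine Matrix.PosSemidef.diagonal fun S => ?_
    simp only [Pi.zero_apply]
    split_ifs
    · simp
    · rw [sub_zero]; exact Complex.zero_le_real.2 (by positivity)
  refine ⟨_, fun i => φ (b i), ∑ S : Finset (Fin d), if S.card = n + 1 then (n + 1 : ℝ) else 0,
    ?_, ?_, ?_, ?_, ?_, ?_⟩
  · obtain ⟨S, -, hS⟩ := Finset.exists_subset_card_eq
      (show n + 1 ≤ (Finset.univ : Finset (Fin d)).card by simp [hd]; omega)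
    refine Finset.sum_pos' (fun T _ => ?_) ⟨S, Finset.mem_univ _, ?_⟩
    · split_ifs <;> positivity
    · rw [if_pos hS]; positivity
  · intro z
    have h1 : ∑ i, z i • φ (b i) = φ (∑ i, z i • b i) := by
      rw [map_sum]; simp only [map_smul]
    rw [h1, ← hφs, ← map_mul, ← map_mul, ← map_smul]
    congr 1
    have h2 : ∑ i, z i • b i = (∑ i, z i • annihilation i) * levelProj d (n + 1) := by
      rw [Finset.sum_mul]; simp only [b, Matrix.smul_mul]
    have h3 : ∑ i, z i • b i = levelProj d n * ∑ i, z i • annihilation i := by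
      rw [Finset.mul_sum]; simp only [hb, Matrix.mul_smul]
    have h4 := mul_conjTranspose_mul_sum_smul_annihilation z
    set A := ∑ i, z i • annihilation i
    have h5 : (∑ i, z i • b i)ᴴ = Aᴴ * levelProj d n := by
      rw [h3, Matrix.conjTranspose_mul, conjTranspose_levelProj]
    rw [h5, h3]
    have h6 : levelProj d n * A = A * levelProj d (n + 1) := h3.symm.trans h2
    calc levelProj d n * A * (Aᴴ * levelProj d n) * (levelProj d n * A)
        = levelProj d n * A * Aᴴ * (levelProj d n * levelProj d n * A) := by
          simp only [Matrix.mul_assoc]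
      _ = levelProj d n * (A * Aᴴ * A) * levelProj d (n + 1) := by
          rw [levelProj_mul_self]
          refine (congrArg (fun M => levelProj d n * A * Aᴴ * M) h6).trans ?_
          simp only [Matrix.mul_assoc]
      _ = ((∑ i, ‖z i‖ ^ 2 : ℝ) : ℂ) • (levelProj d n * (levelProj d n * A)) := by
          rw [h4, Matrix.mul_smul, Matrix.smul_mul, Matrix.mul_assoc, ← h6]
      _ = _ := by rw [← Matrix.mul_assoc, levelProj_mul_self]
  · have : ∑ i, (φ (b i))ᴴ * φ (b i) = φ (∑ i, (b i)ᴴ * b i) := by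
      rw [map_sum]; simp only [map_mul, hφs]
    rw [this, hcol, ← map_one φ, ← map_smul, ← map_sub]
    exact hφp _ (hpos _)
  · have : ∑ i, φ (b i) * (φ (b i))ᴴ = φ (∑ i, b i * (b i)ᴴ) := by
      rw [map_sum]; simp only [map_mul, hφs]
    rw [this, hrow, ← map_one φ, ← map_smul, ← map_sub]
    exact hφp _ (hpos _)
  · intro i j hij
    rw [← hφs, ← map_mul, hφt, hbb]
    exact trace_creation_mul_annihilation_mul_levelProj hij _
  · simp only [← hφs, ← map_mul, hφt]
    rw [← Matrix.trace_sum, hcol, Matrix.trace_diagonal, Complex.ofReal_sum]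
    refine Finset.sum_congr rfl fun S _ => ?_
    split_ifs <;> simp

/-- The trace norm of a combination of partial isometries with coefficients of equal modulus. -/
lemma traceNorm_sum_smul {N d : ℕ} (hd : 0 < d) {a : Fin d → Matrix (Fin N) (Fin N) ℂ} {t : ℝ}
    (hiso : ∀ z : Fin d → ℂ, (∑ i, z i • a i) * (∑ i, z i • a i)ᴴ * (∑ i, z i • a i) =
      ((∑ i, ‖z i‖ ^ 2 : ℝ) : ℂ) • ∑ i, z i • a i)
    (horth : ∀ i j, i ≠ j → ((a i)ᴴ * a j).trace = 0)
    (ht : ∑ i, ((a i)ᴴ * a i).trace = (t : ℂ)) (z : Fin d → ℂ) {r : ℝ} (hz : ∀ i, ‖z i‖ = r) :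
    traceNorm (∑ i, z i • a i) = r * (t / √d) := by
  have hr : 0 ≤ r := hz ⟨0, hd⟩ ▸ norm_nonneg _
  rcases hr.eq_or_lt with rfl | hr
  · have : ∑ i, z i • a i = 0 := Finset.sum_eq_zero fun i _ => by
      rw [norm_eq_zero.1 (hz i), zero_smul]
    rw [this, traceNorm_of_sq_eq 0 0 Matrix.PosSemidef.zero (by simp)]
    simp
  have hs : ∑ i, ‖z i‖ ^ 2 = r ^ 2 * d := by
    simp [hz, mul_comm]
  have hA := hiso z
  have htr : ((∑ i, z i • a i)ᴴ * ∑ i, z i • a i).trace = ((r ^ 2 * t : ℝ) : ℂ) := by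
    rw [conjTranspose_sum, Finset.sum_mul_sum, Matrix.trace_sum, Complex.ofReal_mul, ← ht,
      Finset.mul_sum]
    refine Finset.sum_congr rfl fun i _ => ?_
    rw [Matrix.trace_sum, Finset.sum_eq_single i]
    · rw [conjTranspose_smul, smul_mul_smul_comm, Matrix.trace_smul, smul_eq_mul,
        Complex.star_def, ← Complex.normSq_eq_conj_mul_self, Complex.normSq_eq_norm_sq, hz i]
    · intro j _ hj
      rw [conjTranspose_smul, smul_mul_smul_comm, Matrix.trace_smul, horth i j hj.symm, smul_zero]
    · simp
  set A := ∑ i, z i • a i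
  have hd' : (0 : ℝ) < √d := Real.sqrt_pos.2 (by exact_mod_cast hd)
  have hpos : 0 < r * √d := mul_pos hr hd'
  have hsq : (r * √d) * (r * √d) = r ^ 2 * d := by
    rw [mul_mul_mul_comm, Real.mul_self_sqrt (Nat.cast_nonneg d)]; ring
  -- Since AA*A = (r√d)²A, the modulus of A is A*A/(r√d).
  have hB : ((((r * √d)⁻¹ : ℝ) : ℂ) • (Aᴴ * A)).PosSemidef :=
    (Matrix.posSemidef_conjTranspose_mul_self A).smul
      (Complex.zero_le_real.2 (inv_nonneg.2 hpos.le))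
  rw [traceNorm_of_sq_eq A _ hB, Matrix.trace_smul, htr, smul_eq_mul, ← Complex.ofReal_mul,
    Complex.ofReal_re]
  · field_simp
  · rw [smul_mul_smul_comm, Matrix.mul_assoc, ← Matrix.mul_assoc A, hA, Matrix.mul_smul, smul_smul,
      ← Complex.ofReal_mul, ← Complex.ofReal_mul, hs, ← hsq]
    rw [show (r * √d)⁻¹ * (r * √d)⁻¹ * (r * √d * (r * √d)) = 1 by field_simp]
    simp

end KhintchineZ2

/-! ### Fourier series of the chord length. -/

namespace KhintchineZ2

lemma norm_one_sub_circle_exp {x : ℝ} (h0 : 0 ≤ x) (h1 : x ≤ 1) :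
    ‖(1 : ℂ) - Circle.exp (2 * Real.pi * x)‖ = 2 * Real.sin (Real.pi * x) := by
  rw [norm_sub_rev, Circle.coe_exp, mul_comm, Complex.norm_exp_I_mul_ofReal_sub_one, norm_mul,
    show 2 * Real.pi * x / 2 = Real.pi * x by ring, Real.norm_of_nonneg zero_le_two,
    Real.norm_of_nonneg]
  exact Real.sin_nonneg_of_nonneg_of_le_pi (by positivity) (by nlinarith [Real.pi_pos])

/-- The function `z ↦ ‖1 - z‖` on the unit circle, seen on `ℝ / ℤ`. -/
noncomputable def chordLength : C(AddCircle (1 : ℝ), ℂ) where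
  toFun x := ((‖(1 : ℂ) - AddCircle.toCircle x‖ : ℝ) : ℂ)
  continuous_toFun := by
    have := AddCircle.continuous_toCircle (T := (1 : ℝ))
    fun_prop

lemma fourierCoeff_chordLength (m : ℤ) :
    fourierCoeff chordLength m = ((4 / (Real.pi * (1 - 4 * (m : ℝ) ^ 2)) : ℝ) : ℂ) := by
  have hπ : (Real.pi : ℂ) ≠ 0 := by exact_mod_cast Real.pi_ne_zero
  have h1 : (1 - 2 * m : ℂ) ≠ 0 := by
    have : (1 - 2 * m : ℤ) ≠ 0 := by omega
    exact_mod_cast this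
  have h2 : (1 + 2 * m : ℂ) ≠ 0 := by
    have : (1 + 2 * m : ℤ) ≠ 0 := by omega
    exact_mod_cast this
  have hI := Complex.I_ne_zero
  -- On [0, 1] the chord is 2 sin(πx); times e^(-2πimx) it splits into exponentials with exponents
  -- cx and c'x, both equal to -1 at x = 1.
  set c : ℂ := Real.pi * Complex.I * (1 - 2 * m) with hc
  set c' : ℂ := -(Real.pi * Complex.I * (1 + 2 * m)) with hc'
  have hc0 : c ≠ 0 := mul_ne_zero (mul_ne_zero hπ hI) h1
  have hc0' : c' ≠ 0 := neg_ne_zero.2 (mul_ne_zero (mul_ne_zero hπ hI) h2)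
  have hec : Complex.exp c = -1 := by
    rw [hc, show (Real.pi * Complex.I * (1 - 2 * m) : ℂ) =
      Real.pi * Complex.I - m * (2 * Real.pi * Complex.I) by ring, Complex.exp_sub,
      Complex.exp_int_mul_two_pi_mul_I, Complex.exp_pi_mul_I, div_one]
  have hec' : Complex.exp c' = -1 := by
    rw [hc', show (-(Real.pi * Complex.I * (1 + 2 * m)) : ℂ) =
      -(Real.pi * Complex.I) - m * (2 * Real.pi * Complex.I) by ring, Complex.exp_sub,
      Complex.exp_int_mul_two_pi_mul_I, Complex.exp_neg, Complex.exp_pi_mul_I]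
    norm_num
  have hint : Set.EqOn
      (fun x : ℝ => (fourier (T := (1 : ℝ)) (-m)) (x : AddCircle (1 : ℝ)) • chordLength x)
      (fun x : ℝ => Complex.I * (Complex.exp (c' * x) - Complex.exp (c * x)))
      (Set.uIcc 0 (0 + 1)) := by
    intro x hx
    rw [zero_add, Set.uIcc_of_le zero_le_one] at hx
    have hf : chordLength (x : AddCircle (1 : ℝ)) = 2 * Complex.sin (Real.pi * x) := by
      change ((‖(1 : ℂ) - AddCircle.toCircle (x : AddCircle (1 : ℝ))‖ : ℝ) : ℂ) = _
      rw [AddCircle.toCircle_apply_mk, div_one, norm_one_sub_circle_exp hx.1 hx.2]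
      push_cast; rfl
    simp only [smul_eq_mul]
    rw [hf, fourier_coe_apply, Complex.sin]
    have e1 : Complex.exp (c' * x) =
        Complex.exp (2 * Real.pi * Complex.I * (-m : ℤ) * x / (1 : ℝ)) *
          Complex.exp (-(Real.pi * x) * Complex.I) := by
      rw [← Complex.exp_add, hc']; congr 1; push_cast; ring
    have e2 : Complex.exp (c * x) =
        Complex.exp (2 * Real.pi * Complex.I * (-m : ℤ) * x / (1 : ℝ)) *
          Complex.exp ((Real.pi * x) * Complex.I) := by
      rw [← Complex.exp_add, hc]; congr 1; push_cast; ring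
    rw [e1, e2]; ring
  rw [fourierCoeff_eq_intervalIntegral _ _ 0, intervalIntegral.integral_congr hint,
    intervalIntegral.integral_const_mul, intervalIntegral.integral_sub,
    integral_exp_mul_complex hc0', integral_exp_mul_complex hc0]
  · simp only [zero_add, Complex.ofReal_one, mul_one, Complex.ofReal_zero, mul_zero,
      Complex.exp_zero, hec, hec', div_one, one_smul]
    have h3 : (1 - 4 * (m : ℂ) ^ 2) ≠ 0 := by
      rw [show (1 - 4 * (m : ℂ) ^ 2) = (1 - 2 * m) * (1 + 2 * m) by ring]
      exact mul_ne_zero h1 h2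
    push_cast
    rw [hc, hc', div_sub_div _ _ hc0' hc0, hc, hc', mul_div_assoc', div_eq_div_iff
      (mul_ne_zero hc0' hc0) (mul_ne_zero hπ h3)]
    ring_nf
    rw [hc, hc']
    ring_nf
  · exact (Continuous.intervalIntegrable (by fun_prop) _ _)
  · exact (Continuous.intervalIntegrable (by fun_prop) _ _)

lemma summable_chordLength_coeff :
    Summable fun m : ℤ => (4 / (Real.pi * (1 - 4 * (m : ℝ) ^ 2)) : ℝ) := by
  have h : Summable fun m : ℤ => 4 / Real.pi * (1 / (m : ℝ) ^ 2) :=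
    (Real.summable_one_div_int_pow.2 one_lt_two).mul_left _
  -- The bound fails at m = 0, where the comparison term is 0 by division by zero.
  refine Summable.of_norm_bounded_eventually h ?_
  rw [Filter.eventually_cofinite]
  refine (Set.finite_singleton (0 : ℤ)).subset fun m hm => ?_
  by_contra h0
  refine hm ?_
  have hm1 : (1 : ℝ) ≤ (m : ℝ) ^ 2 := by
    have : (1 : ℤ) ≤ m ^ 2 := Int.add_one_le_iff.2 (sq_pos_of_ne_zero h0)
    exact_mod_cast this
  rw [Real.norm_eq_abs, abs_div, abs_mul, abs_of_pos Real.pi_pos, abs_of_neg (show 1 - 4 * (m : ℝ) ^ 2 < 0 by linarith),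
    div_mul_div_comm, mul_one, abs_of_pos (by norm_num : (0 : ℝ) < 4)]
  have := Real.pi_pos
  gcongr
  linarith

lemma hasSum_norm_one_sub (z : Circle) :
    HasSum (fun m : ℤ => ((4 / (Real.pi * (1 - 4 * (m : ℝ) ^ 2)) : ℝ) : ℂ) * ((z ^ m : Circle) : ℂ))
      ((‖(1 : ℂ) - z‖ : ℝ) : ℂ) := by
  have hs : Summable (fourierCoeff chordLength) := by
    have : fourierCoeff chordLength = fun m : ℤ =>
      ((4 / (Real.pi * (1 - 4 * (m : ℝ) ^ 2)) : ℝ) : ℂ) := funext fourierCoeff_chordLength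
    rw [this]
    exact Complex.ofRealCLM.summable summable_chordLength_coeff
  obtain ⟨x, rfl⟩ : ∃ x : AddCircle (1 : ℝ), AddCircle.toCircle x = z := by
    refine ⟨((Complex.arg z / (2 * Real.pi) : ℝ) : AddCircle (1 : ℝ)), ?_⟩
    rw [AddCircle.toCircle_apply_mk, div_one, mul_div_cancel₀ _ (by positivity), Circle.exp_arg]
  have h := has_pointwise_sum_fourier_series_of_summable hs x
  simp only [fourierCoeff_chordLength, smul_eq_mul, fourier_apply, AddCircle.toCircle_zsmul] at h
  exact h

end KhintchineZ2

/-! ### Means of |1 - χ| over the group. -/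

namespace KhintchineZ2

open scoped MatrixOrder ComplexOrder
open Matrix MeasureTheory

section Characters

variable {G : Type*} [CommGroup G] [TopologicalSpace G]

lemma continuous_coe_character (χ : PontryaginDual G) :
    Continuous fun g => ((χ g : Circle) : ℂ) := by
  have : Continuous χ := map_continuous χ
  fun_prop

lemma zpow_character_apply (χ : PontryaginDual G) (m : ℤ) (g : G) : (χ ^ m) g = χ g ^ m := by
  let ev : PontryaginDual G →* Circle :=
    { toFun := fun ψ => ψ g, map_one' := rfl, map_mul' := fun _ _ => rfl }
  exact map_zpow ev χ m

variable [MeasurableSpace G] [BorelSpace G] (μ : Measure G)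

lemma integrable_character [IsProbabilityMeasure μ] (χ : PontryaginDual G) :
    Integrable (fun g => ((χ g : Circle) : ℂ)) μ :=
  Integrable.of_bound (continuous_coe_character χ).aestronglyMeasurable 1
    (Filter.Eventually.of_forall fun _ => (Circle.norm_coe _).le)

lemma integral_character_of_ne_one [IsTopologicalGroup G] [μ.IsMulLeftInvariant] {χ : PontryaginDual G} (hχ : χ ≠ 1) :
    ∫ g, ((χ g : Circle) : ℂ) ∂μ = 0 := by
  obtain ⟨h, hh⟩ : ∃ h, χ h ≠ 1 := by
    by_contra! hcon
    exact hχ (PontryaginDual.ext hcon)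
  have h1 := integral_mul_left_eq_self (μ := μ) (fun g => ((χ g : Circle) : ℂ)) h
  simp only [map_mul, Circle.coe_mul, integral_const_mul] at h1
  by_contra h0
  refine hh (Circle.ext ?_)
  exact mul_right_cancel₀ h0 (by rw [h1, Circle.coe_one, one_mul])

/-- Integrate the series of |1 - χ| termwise. For m ≠ 0 the mean of χᵐ is 0 or 1 and its coefficient
is negative, so only the zeroth term can contribute positively. -/
lemma integral_norm_one_sub_character_le [IsTopologicalGroup G] [IsProbabilityMeasure μ]
    [μ.IsMulLeftInvariant] (χ : PontryaginDual G) : ∫ g, ‖(1 : ℂ) - χ g‖ ∂μ ≤ 4 / Real.pi := by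
  set c : ℤ → ℝ := fun m => 4 / (Real.pi * (1 - 4 * (m : ℝ) ^ 2)) with hc
  let F : ℤ → G → ℂ := fun m g => (c m : ℂ) * (((χ ^ m) g : Circle) : ℂ)
  have hF : ∀ m, Integrable (F m) μ := fun m => (integrable_character μ _).const_mul _
  have hsum : Summable fun m => ∫ g, ‖F m g‖ ∂μ := by
    have : ∀ m, ∫ g, ‖F m g‖ ∂μ = |c m| := fun m => by
      have h0 : ∀ g, ‖F m g‖ = |c m| := fun g => by
        rw [norm_mul, Circle.norm_coe, mul_one, Complex.norm_real, Real.norm_eq_abs]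
      simp [h0]
    simp only [this]
    exact summable_chordLength_coeff.abs
  have h := hasSum_integral_of_summable_integral_norm hF hsum
  have h1 : ∀ g, ∑' m, F m g = ((‖(1 : ℂ) - χ g‖ : ℝ) : ℂ) := fun g => by
    simp only [F, zpow_character_apply]
    exact (hasSum_norm_one_sub (χ g)).tsum_eq
  have h3 : ∫ g, ∑' m, F m g ∂μ = ((∫ g, ‖(1 : ℂ) - χ g‖ ∂μ : ℝ) : ℂ) :=
    (integral_congr_ae (Filter.Eventually.of_forall h1)).trans integral_ofReal
  rw [h3] at h
  have h2 := Complex.hasSum_re h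
  rw [Complex.ofReal_re] at h2
  refine hasSum_le (fun m => ?_) h2 (hasSum_ite_eq (0 : ℤ) (4 / Real.pi))
  simp only [F, integral_const_mul, Complex.re_ofReal_mul]
  split_ifs with hm
  · simp [hm, hc]
  · by_cases hm1 : χ ^ m = 1
    · have hm2 : (1 : ℝ) ≤ (m : ℝ) ^ 2 := by
        have : (1 : ℤ) ≤ m ^ 2 := Int.add_one_le_iff.2 (sq_pos_of_ne_zero hm)
        exact_mod_cast this
      simp only [hm1, PontryaginDual.one_apply, Circle.coe_one, integral_const, probReal_univ,
        one_smul, Complex.one_re, mul_one, hc]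
      refine div_nonpos_of_nonneg_of_nonpos (by norm_num) ?_
      exact mul_nonpos_of_nonneg_of_nonpos Real.pi_pos.le (by linarith)
    · rw [integral_character_of_ne_one μ hm1]; simp

lemma integral_norm_one_sub_character_of_sq_eq_one [IsTopologicalGroup G]
    [IsProbabilityMeasure μ] [μ.IsMulLeftInvariant] {χ : PontryaginDual G}
    (hχ : χ ≠ 1) (hsq : ∀ g, χ g ^ 2 = 1) : ∫ g, ‖(1 : ℂ) - χ g‖ ∂μ = 1 := by
  have h1 : ∀ g, ‖(1 : ℂ) - χ g‖ = 1 - ((χ g : Circle) : ℂ).re := fun g => by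
    have : ((χ g : Circle) : ℂ) ^ 2 = 1 := by
      rw [← Circle.coe_pow, hsq, Circle.coe_one]
    rw [sq] at this
    rcases mul_self_eq_one_iff.1 this with h | h <;> rw [h] <;> norm_num
  have h2 : ∫ g, ((χ g : Circle) : ℂ).re ∂μ = 0 :=
    (integral_re (integrable_character μ χ)).trans
      (by rw [integral_character_of_ne_one μ hχ]; rfl)
  calc ∫ g, ‖(1 : ℂ) - χ g‖ ∂μ = ∫ g, (1 - ((χ g : Circle) : ℂ).re) ∂μ :=
        integral_congr_ae (Filter.Eventually.of_forall h1)
    _ = ∫ _, (1 : ℝ) ∂μ - ∫ g, ((χ g : Circle) : ℂ).re ∂μ :=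
        integral_sub (integrable_const _) (integrable_character μ χ).re
    _ = 1 := by rw [h2]; simp

end Characters

/-! ### Extraction of disjoint pairs. -/

/-- Greedy choice: each chosen x rules out at most the three points x, xg and xg⁻¹. -/
lemma exists_disjoint_translate {Γ : Type*} [Group Γ] {g : Γ} (hg : g ≠ 1) (m : ℕ)
    (S : Finset Γ) (hS : 3 * m ≤ S.card) :
    ∃ T ⊆ S, T.card = m ∧ ∀ x ∈ T, ∀ y ∈ T, x * g ≠ y := by
  classical
  induction m generalizing S with
  | zero => exact ⟨∅, by simp⟩
  | succ m ih =>
    obtain ⟨x, hx⟩ : S.Nonempty := Finset.card_pos.1 (by omega)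
    obtain ⟨T, hT, hcard, hdis⟩ := ih (S \ {x, x * g, x * g⁻¹}) (by
      have h1 := Finset.le_card_sdiff {x, x * g, x * g⁻¹} S
      have h2 := Finset.card_le_three (a := x) (b := x * g) (c := x * g⁻¹)
      omega)
    have hmem : ∀ y ∈ T, y ∈ S ∧ y ≠ x ∧ y ≠ x * g ∧ y ≠ x * g⁻¹ := fun y hy => by
      simpa using hT hy
    refine ⟨insert x T, ?_, ?_, ?_⟩
    · exact Finset.insert_subset hx fun y hy => (hmem y hy).1
    · rw [Finset.card_insert_of_notMem fun h => (hmem x h).2.1 rfl, hcard]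
    · intro y hy z hz
      rcases Finset.mem_insert.1 hy with rfl | hyT <;> rcases Finset.mem_insert.1 hz with rfl | hzT
      · simpa using hg
      · exact fun h => (hmem z hzT).2.2.1 h.symm
      · exact fun h => (hmem y hyT).2.2.2 (by rw [← h]; group)
      · exact hdis y hyT z hzT

lemma exists_disjoint_pairs {Γ : Type*} [Group Γ] {W : Set Γ} (hW : Z2 W = ⊤) (d : ℕ) :
    ∃ (g : Γ) (x : Fin d → Γ), g ≠ 1 ∧ Function.Injective x ∧ (∀ i, x i ∈ W) ∧
      (∀ i, x i * g ∈ W) ∧ ∀ i j, x i ≠ x j * g := by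
  have h : ((3 * d : ℕ) : ℕ∞) < Z2 W := hW ▸ ENat.natCast_lt_top _
  obtain ⟨g, hg⟩ := lt_iSup_iff.1 h
  obtain ⟨hg1, hg⟩ := lt_iSup_iff.1 hg
  obtain ⟨P, hP, hPc⟩ := Set.exists_subset_encard_eq hg.le
  have hfin : P.Finite := Set.finite_of_encard_eq_coe hPc
  -- With the quotient g fixed, the first entry determines the pair, so 3d pairs give 3d distinct
  -- first entries.
  have hinj : Set.InjOn Prod.fst P := by
    rintro ⟨x, y⟩ hxy ⟨x', y'⟩ hxy' (rfl : x = x')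
    have h1 := (hP hxy).2.2
    have h2 := (hP hxy').2.2
    simp only at h1 h2
    rw [Prod.mk.injEq]
    exact ⟨rfl, mul_left_cancel (h1.trans h2.symm)⟩
  have hS : (hfin.image Prod.fst).toFinset.card = 3 * d := by
    rw [← Nat.cast_inj (R := ℕ∞), ← Set.encard_coe_eq_coe_finsetCard, Set.Finite.coe_toFinset,
      hinj.encard_image, hPc]
  obtain ⟨T, hT, hTc, hdis⟩ := exists_disjoint_translate hg1 d _ hS.ge
  have hmem : ∀ x ∈ T, x ∈ W ∧ x * g ∈ W := fun x hx => by
    obtain ⟨⟨x', y⟩, hp, rfl⟩ := (Set.Finite.mem_toFinset _).1 (hT hx)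
    obtain ⟨h1, h2, h3⟩ := hP hp
    simp only at h1 h2 h3
    exact ⟨h1, by rw [← h3]; simpa using h2⟩
  let e := T.equivFinOfCardEq hTc
  refine ⟨g, fun i => (e.symm i : Γ), hg1, Subtype.val_injective.comp e.symm.injective,
    fun i => (hmem _ (e.symm i).2).1, fun i => (hmem _ (e.symm i).2).2, fun i j h => ?_⟩
  exact hdis _ (e.symm j).2 _ (e.symm i).2 h.symm

/-! ### The test family and the conclusion. -/

section Main

variable {G : Type*} [CommGroup G] [TopologicalSpace G] [IsTopologicalGroup G] [CompactSpace G]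

/-- The mean of `‖1 - χ‖` over the group. -/
noncomputable def meanChord (χ : PontryaginDual G) : ℝ :=
  letI : MeasurableSpace G := borel G
  ∫ g, ‖(1 : ℂ) - χ g‖ ∂(haarProb G)

lemma meanChord_eq (χ : PontryaginDual G) [MeasurableSpace G] [BorelSpace G] :
    meanChord χ =
      ∫ g, ‖(1 : ℂ) - χ g‖ ∂(Measure.haarMeasure (⊤ : TopologicalSpace.PositiveCompacts G)) := by
  obtain rfl := BorelSpace.measurable_eq (α := G)
  rfl

lemma isProbabilityMeasure_haarMeasure_top [MeasurableSpace G] [BorelSpace G] :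
    IsProbabilityMeasure (Measure.haarMeasure (⊤ : TopologicalSpace.PositiveCompacts G)) :=
  ⟨Measure.haarMeasure_self (K₀ := (⊤ : TopologicalSpace.PositiveCompacts G))⟩

lemma meanChord_le (χ : PontryaginDual G) : meanChord χ ≤ 4 / Real.pi := by
  let _ : MeasurableSpace G := borel G
  have : BorelSpace G := ⟨rfl⟩
  have := isProbabilityMeasure_haarMeasure_top (G := G)
  rw [meanChord_eq]
  exact integral_norm_one_sub_character_le _ χ

lemma meanChord_of_sq_eq_one {χ : PontryaginDual G} (hχ : χ ≠ 1) (hsq : ∀ g, χ g ^ 2 = 1) :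
    meanChord χ = 1 := by
  let _ : MeasurableSpace G := borel G
  have : BorelSpace G := ⟨rfl⟩
  have := isProbabilityMeasure_haarMeasure_top (G := G)
  rw [meanChord_eq]
  exact integral_norm_one_sub_character_of_sq_eq_one _ hχ hsq

/-- Testing the lower Khintchine inequality on a family of pairs with a common quotient `χ`. -/
lemma LowerKhintchine.sq_mul_le {W : Set (PontryaginDual G)} {K c : ℝ} (hK : LowerKhintchine W K)
    (hK0 : 0 < K) (n : ℕ) {χ : PontryaginDual G} (hχ : meanChord χ ≤ 2 * c)
    {x : Fin (2 * n + 1) → PontryaginDual G} (hx : Function.Injective x) (hxW : ∀ i, x i ∈ W)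
    (hxχW : ∀ i, x i * χ ∈ W) (hne : ∀ i j, x i ≠ x j * χ) :
    K ^ 2 * (2 * n + 1) ≤ c ^ 2 * (2 * n + 2) := by
  obtain ⟨N, a, t, ht0, hiso, hcol, hrow, horth, ht⟩ := exists_partial_isometry_family n
  have hmain := hK N _ (Fin.append a (fun i => -a i)) (Fin.append x fun i => x i * χ)
    (Fin.append_injective_iff.2 ⟨hx, fun i j h => hx (mul_right_cancel h), hne⟩)
    (Fin.addCases (fun i => by rw [Fin.append_left]; exact hxW i)
      fun i => by rw [Fin.append_right]; exact hxχW i)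
  have hchar : characterSumNorm (Fin.append a (fun i => -a i)) (Fin.append x fun i => x i * χ) =
      meanChord χ * (t / √((2 * n + 1 : ℕ) : ℝ)) := by
    unfold characterSumNorm meanChord
    rw [← integral_mul_const]
    congr 1
    ext g
    rw [← traceNorm_sum_smul (Nat.succ_pos _) hiso horth ht
      (fun i => ((x i g : Circle) : ℂ) * (1 - χ g))
      (fun i => by rw [norm_mul, Circle.norm_coe, one_mul])]
    congr 1
    rw [Fin.sum_univ_add, ← Finset.sum_add_distrib]
    refine Finset.sum_congr rfl fun i _ => ?_
    rw [Fin.append_left, Fin.append_left, Fin.append_right, Fin.append_right,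
      show (x i * χ) g = x i g * χ g from rfl, Circle.coe_mul, smul_neg, ← sub_eq_add_neg,
      ← sub_smul, mul_sub, mul_one]
  -- Each half of the doubled family contributes at most n+1 to either square sum, hence β² =
  -- 2(n+1).
  set β : ℝ := √(2 * (n + 1)) with hβ
  have hβ2 : β ^ 2 = (n + 1) + (n + 1) := by rw [hβ, Real.sq_sqrt (by positivity)]; ring
  have hrc : 2 * t ≤ β * rcNorm (Fin.append a (fun i => -a i)) := by
    refine le_trans (le_of_eq ?_) (re_sum_trace_le_rcNorm _ (Real.sqrt_nonneg _) ?_ ?_)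
    · rw [Fin.sum_univ_add]
      simp only [Fin.append_left, Fin.append_right, conjTranspose_neg, neg_mul_neg, ht]
      rw [Complex.add_re, Complex.ofReal_re]; ring
    · rw [hβ2, Complex.ofReal_add, add_smul, Fin.sum_univ_add]
      simp only [Fin.append_left, Fin.append_right, conjTranspose_neg, neg_mul_neg]
      rw [add_sub_add_comm]
      exact hcol.add hcol
    · rw [hβ2, Complex.ofReal_add, add_smul, Fin.sum_univ_add]
      simp only [Fin.append_left, Fin.append_right, conjTranspose_neg, neg_mul_neg]
      rw [add_sub_add_comm]
      exact hrow.add hrow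
  rw [hchar] at hmain
  set s : ℝ := √((2 * n + 1 : ℕ) : ℝ) with hs
  have hs2 : s ^ 2 = 2 * n + 1 := by rw [hs, Real.sq_sqrt (by positivity)]; push_cast; ring
  have hs0 : 0 < s := Real.sqrt_pos.2 (by positivity)
  have hβ0 : 0 ≤ β := Real.sqrt_nonneg _
  have h1 : K * (2 * t) ≤ β * (2 * c * (t / s)) :=
    calc K * (2 * t) ≤ K * (β * rcNorm (Fin.append a (fun i => -a i))) := by gcongr
      _ = β * (K * rcNorm (Fin.append a (fun i => -a i))) := by ring
      _ ≤ β * (meanChord χ * (t / s)) := by gcongr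
      _ ≤ β * (2 * c * (t / s)) := by gcongr
  have h2 : K * s ≤ β * c := by
    have h3 : β * (2 * c * (t / s)) = (β * c) * (2 * t) / s := by ring
    rw [h3, le_div_iff₀ hs0] at h1
    refine le_of_mul_le_mul_right (a := 2 * t) ?_ (by positivity)
    linarith
  have h4 := pow_le_pow_left₀ (by positivity) h2 2
  rw [mul_pow, mul_pow, hs2, hβ2] at h4
  linarith

/-- A set of characters with lower Khintchine constant exceeding half the mean of `‖1 - χ‖` for all
nontrivial `χ` is a `Z(2)` set. -/
theorem LowerKhintchine.z2_lt_top {W : Set (PontryaginDual G)} {K c : ℝ}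
    (hK : LowerKhintchine W K) (hc : 0 < c) (hcK : c < K)
    (hmean : ∀ χ : PontryaginDual G, χ ≠ 1 → meanChord χ ≤ 2 * c) : Z2 W < ⊤ := by
  by_contra htop
  have hW : Z2 W = ⊤ := not_lt_top_iff.1 htop
  have hlt : 0 < K ^ 2 - c ^ 2 := sub_pos.2 (pow_lt_pow_left₀ hcK hc.le two_ne_zero)
  -- With n(K² - c²) > c², K²(2n+1) exceeds c²(2n+2).
  obtain ⟨n, hn⟩ := exists_nat_gt (c ^ 2 / (K ^ 2 - c ^ 2))
  rw [div_lt_iff₀ hlt] at hn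
  obtain ⟨χ, x, hχ, hx, hxW, hxχW, hne⟩ := exists_disjoint_pairs hW (2 * n + 1)
  have h := hK.sq_mul_le (hc.trans hcK) n (hmean χ hχ) hx hxW hxχW hne
  nlinarith [sq_nonneg K, sq_nonneg c]

end Main

end KhintchineZ2

theorem theorem3p8 :
    (∀ (m : ℕ) (k : Fin m → ℕ) [∀ i, NeZero (k i)] (Λ : Type*)
      (W : Set (PontryaginDual ((∀ i, Multiplicative (ZMod (k i))) × (Λ → Circle)))),
      (∃ K : ℝ, 2 / Real.pi < K ∧ KhintchineZ2.LowerKhintchine W K) →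
        KhintchineZ2.Z2 W < ⊤) ∧
    (∀ (Λ : Type*) (W : Set (PontryaginDual (Λ → Multiplicative (ZMod 2)))),
      (∃ K : ℝ, 1 / 2 < K ∧ KhintchineZ2.LowerKhintchine W K) →
        KhintchineZ2.Z2 W < ⊤) := by
  refine ⟨fun m k _ Λ W ⟨K, hK, hW⟩ => ?_, fun Λ W ⟨K, hK, hW⟩ => ?_⟩
  · refine hW.z2_lt_top (div_pos two_pos Real.pi_pos) hK fun χ _ => ?_
    refine (KhintchineZ2.meanChord_le χ).trans (le_of_eq ?_)
    ring
  · refine hW.z2_lt_top one_half_pos hK fun χ hχ => ?_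
    -- The group has exponent 2, so its characters take only the values ±1.
    rw [KhintchineZ2.meanChord_of_sq_eq_one hχ fun g => ?_]
    · norm_num
    · have hg : g ^ 2 = 1 := by
        ext i
        exact congrArg Multiplicative.ofAdd (show 2 • (g i).toAdd = 0 from CharTwo.two_nsmul _)
      rw [← map_pow, hg, map_one]
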